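/- Let $X$ be a measurable space of inputs, with labels in $\{0,1\}$, and let $\mathcal H=\{f_\theta:X\to\{0,1\}\}_{\theta\in\Theta}$ be a class of binary classifiers of VC-dimension $d<\infty$, where $\Theta$ is a standard Borel space and $(\theta,x)\mapsto f_\theta(x)$ is measurable. For a probability distribution $\mathcal D$ of labelled examples $(x,y)\in X\times\{0,1\}$ and a dataset $S=((x_1,y_1),\dots,(x_N,y_N))$ of size $|S|=N\ge 1$, let $$L(f,\mathcal D)=\Pr_{(x,y)\sim\mathcal D}[f(x)\ne y],\qquad L(f,S)=\frac1N\sum_{i=1}^N \mathbf 1[f(x_i)\ne y_i],$$ and let $$d_{\mathcal H\Delta\mathcal H}(\mathcal D,\mathcal D')=2\sup_{h,h'\in\mathcal H}\Big|\Pr_{x\sim\mathcal D}[h(x)\ne h'(x)]-\Pr_{x\sim\mathcal D'}[h(x)\ne h'(x)]\Big|,$$ where only the input $x$ of an example is used. Let $\mathcal D^q_1,\dots,\mathcal D^q_R$ (the clusters of cloud data) and $\mathcal D^p$ (the client data) be probability distributions of labelled examples, let $\alpha_r\in[0,1]$ with $\sum_{r=1}^R\alpha_r=1$, let $S$ be drawn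 i.i.d. from the mixture $\mathcal D^q=\sum_{r=1}^R\alpha_r\mathcal D^q_r$, and let $0<p<1$. Then with probability at least $1-p$ over the choice of $S$, the following holds for every $\theta\in\Theta$, and hence for every parameter $\theta$ obtained by training on $S$: $$L(f_\theta,\mathcal D^p)\le L(f_\theta,S)+\frac12\sum_{r=1}^R\alpha_r\,d_{\mathcal H\Delta\mathcal H}(\mathcal D^q_r,\mathcal D^p)+4\sqrt{\frac{2d\log(2|S|)+\log(4/p)}{|S|}}+\xi,$$ both with the joint optimal loss $\xi=\inf_{\theta'\in\Theta}\{L(f_{\theta'},S)+L(f_{\theta'},\mathcal D^p)\}$ and with $\xi=\inf_{\theta'\in\Theta}\{L(f_{\theta'},\mathcal D^q)+L(f_{\theta'},\mathcal D^p)\}$. -/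

import Mathlib

noncomputable section

namespace DomainAdaptation

open MeasureTheory

/-- A finite set `s` of points is shattered by the parametrised class `f` of binary classifiers:
every subset of `s` is cut out by some classifier of the class. -/
def Shatters {Θ X : Type*} (f : Θ → X → Bool) (s : Finset X) : Prop :=
  ∀ t ⊆ s, ∃ θ, ∀ x ∈ s, (f θ x = true ↔ x ∈ t)

/-- The Vapnik-Chervonenkis dimension: the largest size of a shattered finite set
(`⊤` if there are arbitrarily large ones). -/
def vcDim {Θ X : Type*} (f : Θ → X → Bool) : ℕ∞ :=
  ⨆ (s : Finset X) (_ : Shatters f s), (s.card : ℕ∞)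

/-- The zero-one loss of a binary classifier on a labelled example. -/
def zeroOneLoss {X : Type*} (h : X → Bool) (z : X × Bool) : ℝ :=
  if h z.1 = z.2 then 0 else 1

/-- Generalization error: the expected loss under a distribution of labelled examples. -/
def expectedLoss {X : Type*} [MeasurableSpace X] (h : X → Bool) (D : Measure (X × Bool)) : ℝ :=
  ∫ z, zeroOneLoss h z ∂D

/-- Empirical error: the average loss over a dataset of `N` labelled examples. -/
def empiricalLoss {X : Type*} {N : ℕ} (h : X → Bool) (S : Fin N → X × Bool) : ℝ :=
  (∑ i, zeroOneLoss h (S i)) / N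

/-- The divergence
`d_{HΔH}(P, Q) = 2 sup { |P(A) - Q(A)| : A = {x | h x ≠ h' x}, h and h' in H }`
between two distributions of inputs, for the class `H = {f θ}`. -/
def hDeltaHDiv {Θ X : Type*} [MeasurableSpace X] (f : Θ → X → Bool) (P Q : Measure X) : ℝ :=
  2 * ⨆ τ : Θ × Θ, |P.real {x | f τ.1 x ≠ f τ.2 x} - Q.real {x | f τ.1 x ≠ f τ.2 x}|

/-- The mixture `∑ r, α r • D r`. -/
def mixture {Z : Type*} [MeasurableSpace Z] {R : ℕ} (α : Fin R → ℝ) (D : Fin R → Measure Z) :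
    Measure Z :=
  ∑ r, ENNReal.ofReal (α r) • D r

/-- The joint optimal loss on a dataset and a distribution. -/
def jointLossEmp {Θ X : Type*} [MeasurableSpace X] {N : ℕ} (f : Θ → X → Bool)
    (S : Fin N → X × Bool) (D : Measure (X × Bool)) : ℝ :=
  ⨅ θ, (empiricalLoss (f θ) S + expectedLoss (f θ) D)

/-- The joint optimal loss on two distributions. -/
def jointLoss {Θ X : Type*} [MeasurableSpace X] (f : Θ → X → Bool)
    (Q D : Measure (X × Bool)) : ℝ :=
  ⨅ θ, (expectedLoss (f θ) Q + expectedLoss (f θ) D)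

/-- The right-hand side of the bound, with joint optimal loss `ξ`: `N` is the sample size, `d` the
VC-dimension and `p` the failure probability. The divergence compares the distributions of the
inputs, that is, the first marginals. -/
def errorBound {Θ X : Type*} [MeasurableSpace X] {N R : ℕ} (f : Θ → X → Bool) (d : ℕ) (p : ℝ)
    (α : Fin R → ℝ) (Dq : Fin R → Measure (X × Bool)) (Dp : Measure (X × Bool))
    (S : Fin N → X × Bool) (θ : Θ) (ξ : ℝ) : ℝ :=
  empiricalLoss (f θ) S
    + 1 / 2 * ∑ r, α r * hDeltaHDiv f (Dq r).fst Dp.fst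
    + 4 * Real.sqrt ((2 * d * Real.log (2 * N) + Real.log (4 / p)) / N)
    + ξ

end DomainAdaptation

end

/-!
The argument combines a one-sided uniform deviation inequality for the source mixture with a
triangle inequality that moves the loss from the source to the target.

*Triangle inequality.* For any comparison classifier `f θ'`, the target loss of `f θ` is at most the
target loss of `f θ'` plus the target probability that the two disagree. The latter exceeds the
corresponding probability under the mixture by at most half the averaged divergence, and under the
mixture two classifiers disagree at most as often as one of them errs
(`DomainAdaptation.expectedLoss_le_comparison`). Write `s` for the square root in the bound. If
every classifier has mixture loss at most its empirical loss plus `2 * s`, then one deviation (for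
`θ`) gives the bound with the population joint loss and two (for `θ` and `θ'`) give the bound with
the empirical one, which is where the factor `4` comes from.

*Uniform deviation.* By Hoeffding's inequality a ghost sample shows at least three quarters of a
deviation of the first sample with probability at least one half
(`DomainAdaptation.measure_exists_deviation_le`). The law of the double sample is invariant under
exchanging paired examples, so it suffices to bound, for a fixed double sample, the fraction of
exchanges that produce a large gap. By the Sauer-Shelah lemma there are at most `(2 * N + 1) ^ d`
traces, and for each trace Hoeffding's inequality for random signs applies
(`DomainAdaptation.card_swapPairs_le`).

*Measurability.* The class is uncountable, so the event that some classifier has a large gap is only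
the projection of a measurable set along `Θ`. As `Θ` is standard Borel, this projection is
null-measurable (`nullMeasurableSet_exists_prod_mem`): the base is reduced to the Cantor space, where
the projection is analytic, and analytic sets are universally measurable by Choquet's capacitability
argument. The event of a large deviation itself is only estimated in outer measure, and the set of
good samples is the complement of its measurable hull.
-/

noncomputable section

open MeasureTheory Set Filter Topology

/-! ### Universal measurability of analytic sets and of projections -/

/-- One step of the proof of Choquet's capacitability theorem: from the image of a set of sequences
of naturals, bounding one coordinate loses an arbitrarily small amount of outer measure. -/
theorem exists_bound_lt_measure_image {Z : Type*} [MeasurableSpace Z] (μ : Measure Z)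
    (g : (ℕ → ℕ) → Z) {c : ENNReal} (A : Set (ℕ → ℕ)) (hA : c < μ (g '' A)) (k : ℕ) :
    ∃ j, c < μ (g '' (A ∩ {x | x k ≤ j})) := by
  have hU : g '' A = ⋃ j, g '' (A ∩ {x | x k ≤ j}) := by
    rw [← image_iUnion, ← inter_iUnion]
    congr 1
    refine (inter_eq_left.2 fun x _ => ?_).symm
    exact mem_iUnion.2 ⟨x k, mem_ofPred.2 le_rfl⟩
  have hmono : Monotone fun j => g '' (A ∩ {x | x k ≤ j}) := fun i j hij =>
    image_mono (inter_subset_inter_right _ fun x (hx : x k ≤ i) => hx.trans hij)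
  rw [hU, hmono.measure_iUnion] at hA
  exact lt_iSup_iff.1 hA

theorem isCompact_setOf_forall_le (n : ℕ → ℕ) : IsCompact {x : ℕ → ℕ | ∀ i, x i ≤ n i} := by
  convert isCompact_Icc (a := (0 : ℕ → ℕ)) (b := n) using 1
  ext x; simp [Pi.le_def]

/-- Sequences of naturals satisfying the first `k` of the bounds `x i ≤ n i` lie, for `k` large,
in any given neighbourhood of the compact set of sequences satisfying all of them. -/
theorem exists_boundedPrefix_subset (n : ℕ → ℕ) {O : Set (ℕ → ℕ)} (hO : IsOpen O)
    (hK : {x : ℕ → ℕ | ∀ i, x i ≤ n i} ⊆ O) :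
    ∃ k, {x : ℕ → ℕ | ∀ i < k, x i ≤ n i} ⊆ O := by
  by_contra! hcon
  simp only [not_subset] at hcon
  choose x hx hxO using hcon
  have hKc := isCompact_setOf_forall_le n
  obtain ⟨a, ha, φ, hφ, hlim⟩ := hKc.tendsto_subseq
    (x := fun k i => min (x k i) (n i)) (fun k i => min_le_right _ _)
  have hlim' : Tendsto (x ∘ φ) atTop (𝓝 a) := by
    rw [tendsto_pi_nhds] at hlim ⊢
    intro i
    refine (hlim i).congr' ?_
    filter_upwards [eventually_gt_atTop i] with k hk
    exact min_eq_left (hx (φ k) i (hk.trans_le (hφ.id_le k)))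
  exact hO.isClosed_compl.mem_of_tendsto hlim' (Eventually.of_forall fun k => hxO (φ k)) (hK ha)

/-- The image of Baire space under a continuous map is capacitable: its outer measure is approached
from inside by images of compact sets. -/
theorem exists_isCompact_le_measure_image {Z : Type*} [TopologicalSpace Z] [T2Space Z]
    [MeasurableSpace Z] [OpensMeasurableSpace Z] (μ : Measure Z) [IsFiniteMeasure μ]
    {g : (ℕ → ℕ) → Z} (hg : Continuous g) {c : ENNReal} (hc : c < μ (range g)) :
    ∃ K : Set (ℕ → ℕ), IsCompact K ∧ c ≤ μ (g '' K) := by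
  choose j hj using fun (A : {A : Set (ℕ → ℕ) // c < μ (g '' A)}) (k : ℕ) =>
    exists_bound_lt_measure_image μ g A.1 A.2 k
  let A : ℕ → {A : Set (ℕ → ℕ) // c < μ (g '' A)} := fun k =>
    Nat.rec ⟨univ, by rwa [image_univ]⟩ (fun k A => ⟨A.1 ∩ {x | x k ≤ j A k}, hj A k⟩) k
  set n : ℕ → ℕ := fun k => j (A k) k with hn
  have hA : ∀ k, (A k).1 = {x | ∀ i < k, x i ≤ n i} := by
    intro k
    induction k with
    | zero => simp [A]
    | succ k ih =>
      change (A k).1 ∩ {x | x k ≤ n k} = _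
      rw [ih]
      ext x
      simp only [mem_inter_iff, mem_ofPred_eq, Nat.lt_succ_iff_lt_or_eq]
      constructor
      · rintro ⟨h1, h2⟩ i (hi | rfl)
        exacts [h1 i hi, h2]
      · exact fun h => ⟨fun i hi => h i (Or.inl hi), h k (Or.inr rfl)⟩
  have hKc := isCompact_setOf_forall_le n
  refine ⟨_, hKc, ?_⟩
  have hsub : ⋂ k, closure (g '' (A k).1) ⊆ g '' {x | ∀ i, x i ≤ n i} := by
    intro y hy
    by_contra hyK
    obtain ⟨U, V, hU, hV, hKU, hyV, hUV⟩ := SeparatedNhds.of_isCompact_isCompact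
      (hKc.image hg) isCompact_singleton (disjoint_singleton_right.2 hyK)
    obtain ⟨k, hk⟩ := exists_boundedPrefix_subset n (hU.preimage hg) (image_subset_iff.1 hKU)
    have hyk := mem_iInter.1 hy k
    rw [hA, mem_closure_iff] at hyk
    obtain ⟨z, hzV, hzA⟩ := hyk V hV (hyV rfl)
    exact disjoint_left.1 hUV (image_subset_iff.2 hk hzA) hzV
  have hanti : Antitone fun k => closure (g '' (A k).1) := by
    refine antitone_nat_of_succ_le fun k => closure_mono (image_mono ?_)
    exact inter_subset_left
  refine le_trans ?_ (measure_mono hsub)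
  rw [hanti.measure_iInter (fun k => isClosed_closure.measurableSet.nullMeasurableSet)
    ⟨0, measure_ne_top _ _⟩]
  exact le_iInf fun k => (A k).2.le.trans (measure_mono subset_closure)

/-- Analytic sets are universally measurable. -/
theorem MeasureTheory.AnalyticSet.nullMeasurableSet {Z : Type*} [TopologicalSpace Z] [T2Space Z]
    [MeasurableSpace Z] [OpensMeasurableSpace Z] {s : Set Z} (hs : AnalyticSet s)
    (μ : Measure Z) [IsFiniteMeasure μ] : NullMeasurableSet s μ := by
  rw [AnalyticSet] at hs
  rcases hs with rfl | ⟨g, hg, rfl⟩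
  · exact nullMeasurableSet_empty
  rcases eq_or_ne (μ (range g)) 0 with h0 | h0
  · exact NullMeasurableSet.of_null h0
  obtain ⟨u, -, hu, hlim⟩ := exists_seq_strictMono_tendsto' (pos_iff_ne_zero.2 h0)
  choose K hK hle using fun k => exists_isCompact_le_measure_image μ hg (hu k).2
  have hT : MeasurableSet (⋃ k, g '' K k) :=
    MeasurableSet.iUnion fun k => ((hK k).image hg).measurableSet
  refine hT.nullMeasurableSet.congr
    (ae_eq_of_subset_of_measure_ge (iUnion_subset fun k => image_subset_range _ _) ?_
      hT.nullMeasurableSet (measure_ne_top _ _))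
  exact le_of_tendsto' hlim fun k => (hle k).trans (measure_mono (subset_iUnion (fun k => g '' K k) k))

/-- A measurable subset of `Θ × Z` is determined by countably many measurable subsets of `Z`: it is
pulled back from a measurable subset of `Θ × 2^ℕ`. -/
theorem MeasurableSet.exists_prod_preimage_cantor {Θ Z : Type*} [MeasurableSpace Θ]
    [MeasurableSpace Z] {C : Set (Θ × Z)} (hC : MeasurableSet C) :
    ∃ φ : Z → ℕ → Bool, Measurable φ ∧ ∃ C' : Set (Θ × (ℕ → Bool)), MeasurableSet C' ∧
      C = Prod.map id φ ⁻¹' C' := by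
  rw [← generateFrom_prod] at hC
  induction C, hC using MeasurableSpace.generateFrom_induction with
  | hC t ht _ =>
    classical
    obtain ⟨A, hA, B, hB, rfl⟩ := ht
    refine ⟨fun z _ => decide (z ∈ B), ?_, A ×ˢ {y | y 0 = true}, ?_, ?_⟩
    · refine measurable_pi_lambda _ fun _ => measurable_to_bool ?_
      convert (show MeasurableSet B from hB) using 1
      ext z; simp
    · exact (show MeasurableSet A from hA).prod
        (measurableSet_eq_fun (measurable_pi_apply 0) measurable_const)
    · ext ⟨a, z⟩; simp
  | empty => exact ⟨fun _ _ => false, measurable_const, ∅, MeasurableSet.empty, by simp⟩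
  | compl t _ ih =>
    obtain ⟨φ, hφ, C', hC', rfl⟩ := ih
    exact ⟨φ, hφ, C'ᶜ, hC'.compl, rfl⟩
  | iUnion s _ ih =>
    choose φ hφ C' hC' hs using ih
    refine ⟨fun z m => φ m.unpair.1 z m.unpair.2,
      measurable_pi_lambda _ fun m => (measurable_pi_apply _).comp (hφ _),
      ⋃ k, Prod.map id (fun y m => y (Nat.pair k m)) ⁻¹' C' k, ?_, ?_⟩
    · refine MeasurableSet.iUnion fun k => ?_
      exact (measurable_id.prodMap (measurable_pi_lambda _ fun m => measurable_pi_apply _)) (hC' k)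
    · ext ⟨a, z⟩
      simp only [mem_iUnion, mem_preimage, Prod.map, id, Nat.unpair_pair]
      refine exists_congr fun k => ?_
      rw [hs k]
      rfl

/-- **Measurable projection theorem**, for an arbitrary measurable base: the projection of a
measurable set along a standard Borel space is universally measurable. -/
theorem nullMeasurableSet_exists_prod_mem {Θ Z : Type*} [MeasurableSpace Θ] [StandardBorelSpace Θ]
    [MeasurableSpace Z] {C : Set (Θ × Z)} (hC : MeasurableSet C) (μ : Measure Z)
    [IsFiniteMeasure μ] : NullMeasurableSet {z | ∃ θ, (θ, z) ∈ C} μ := by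
  obtain ⟨φ, hφ, C', hC', rfl⟩ := hC.exists_prod_preimage_cantor
  have h : NullMeasurableSet (Prod.snd '' C') (μ.map φ) :=
    (hC'.analyticSet_image measurable_snd).nullMeasurableSet _
  convert h.preimage (hφ.quasiMeasurePreserving μ) using 1
  ext z
  simp [Prod.map]

namespace DomainAdaptation

/-! ### Growth function -/

theorem Shatters.card_le_of_vcDim_le {Θ X : Type*} {f : Θ → X → Bool} {s : Finset X}
    (hs : Shatters f s) {d : ℕ} (hd : vcDim f ≤ d) : s.card ≤ d := by
  have h : (s.card : ℕ∞) ≤ vcDim f := le_iSup₂ (f := fun s _ => (s.card : ℕ∞)) s hs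
  exact_mod_cast h.trans hd

open scoped Classical in
/-- The traces of the class `f` on a finite family of points: the sets of indices labelled `true`
by some classifier. The family may have repetitions. -/
def traces {Θ X ι : Type*} [Fintype ι] (f : Θ → X → Bool) (z : ι → X) : Finset (Finset ι) :=
  Finset.univ.filter fun t => ∃ θ, ∀ i, i ∈ t ↔ f θ (z i) = true

open scoped Classical in
/-- A set of indices shattered by the traces carries distinct points, so these are shattered by the
class. -/
theorem card_le_of_shatters_traces {Θ X ι : Type*} [Fintype ι] {f : Θ → X → Bool} {z : ι → X}
    {u : Finset ι} (hu : (traces f z).Shatters u) {d : ℕ} (hd : vcDim f ≤ d) : u.card ≤ d := by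
  have key : ∀ t ⊆ u, ∃ θ, ∀ i ∈ u, (f θ (z i) = true ↔ i ∈ t) := by
    intro t ht
    obtain ⟨v, hv, rfl⟩ := hu ht
    obtain ⟨θ, hθ⟩ := (Finset.mem_filter.1 hv).2
    exact ⟨θ, fun i hi => by rw [← hθ i]; simp [hi]⟩
  have hinj : Set.InjOn z u := by
    intro i hi j hj hij
    obtain ⟨θ, hθ⟩ := key {i} (by simpa using hi)
    have h1 : f θ (z i) = true := (hθ i hi).2 (by simp)
    have h2 := (hθ j hj).1 (hij ▸ h1)
    exact (Finset.mem_singleton.1 h2).symm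
  rw [← Finset.card_image_of_injOn hinj]
  refine Shatters.card_le_of_vcDim_le (f := f) (fun t ht => ?_) hd
  obtain ⟨θ, hθ⟩ := key (u.filter fun i => z i ∈ t) (Finset.filter_subset _ _)
  refine ⟨θ, fun x hx => ?_⟩
  obtain ⟨i, hi, rfl⟩ := Finset.mem_image.1 hx
  rw [hθ i hi]
  simp [hi]

theorem sum_choose_le_add_one_pow (m d : ℕ) : ∑ k ∈ Finset.Iic d, m.choose k ≤ (m + 1) ^ d := by
  rw [add_pow, Nat.range_succ_eq_Iic]
  refine Finset.sum_le_sum fun k hk => ?_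
  rw [one_pow, mul_one]
  exact (Nat.choose_le_pow m k).trans
    (Nat.le_mul_of_pos_right _ (Nat.choose_pos (Finset.mem_Iic.1 hk)))

/-- **Sauer-Shelah lemma**: a class of VC-dimension at most `d` has polynomially many traces. -/
theorem card_traces_le {Θ X ι : Type*} [Fintype ι] (f : Θ → X → Bool) (z : ι → X) {d : ℕ}
    (hd : vcDim f ≤ d) : (traces f z).card ≤ (Fintype.card ι + 1) ^ d := by
  classical
  have hvc : (traces f z).vcDim ≤ d := Finset.sup_le fun u hu =>
    card_le_of_shatters_traces (by convert Finset.mem_shatterer.1 hu) hd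
  refine (Finset.card_le_card_shatterer _).trans (Finset.card_shatterer_le_sum_vcDim.trans ?_)
  refine le_trans ?_ (sum_choose_le_add_one_pow _ d)
  exact Finset.sum_le_sum_of_subset (Finset.Iic_subset_Iic.2 hvc)

/-! ### Random signs -/

/-- Hoeffding's inequality for random signs, in counting form. -/
theorem card_signs_le {N : ℕ} (a : Fin N → ℝ) (ha : ∀ i, |a i| ≤ 1) {t : ℝ} (ht : 0 ≤ t) :
    ((Finset.univ.filter fun σ : Fin N → Bool =>
      N * t ≤ ∑ i, if σ i then -a i else a i).card : ℝ) ≤ 2 ^ N * Real.exp (-(N * t ^ 2 / 2)) := by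
  have hsum : ∑ σ : Fin N → Bool, Real.exp (t * ∑ i, if σ i then -a i else a i)
      = ∏ i, (2 * Real.cosh (t * a i)) := by
    have h := Finset.prod_univ_sum (fun _ : Fin N => (Finset.univ : Finset Bool))
      (fun i b => Real.exp (t * if b then -a i else a i))
    rw [Fintype.piFinset_univ] at h
    simp_rw [Finset.mul_sum, Real.exp_sum]
    rw [← h]
    refine Finset.prod_congr rfl fun i _ => ?_
    rw [Fintype.sum_bool, Real.cosh_eq]
    simp only [if_true, Bool.false_eq_true, if_false, mul_neg]
    ring
  have hcosh : ∏ i, (2 * Real.cosh (t * a i)) ≤ 2 ^ N * Real.exp (N * t ^ 2 / 2) := by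
    have h1 : ∀ i ∈ (Finset.univ : Finset (Fin N)),
        2 * Real.cosh (t * a i) ≤ 2 * Real.exp (t ^ 2 / 2) := by
      intro i _
      refine mul_le_mul_of_nonneg_left ((Real.cosh_le_exp_half_sq _).trans ?_) zero_le_two
      have : a i ^ 2 ≤ 1 := (sq_le_one_iff_abs_le_one _).2 (ha i)
      rw [Real.exp_le_exp, mul_pow]
      nlinarith [sq_nonneg t]
    refine (Finset.prod_le_prod (fun i _ => by positivity) h1).trans_eq ?_
    rw [Finset.prod_const, Finset.card_univ, Fintype.card_fin, mul_pow, ← Real.exp_nat_mul]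
    congr 2; ring
  -- Chernoff's bound with exponent `t`
  have hle : ((Finset.univ.filter fun σ : Fin N → Bool =>
      N * t ≤ ∑ i, if σ i then -a i else a i).card : ℝ)
      ≤ ∑ σ : Fin N → Bool,
        Real.exp (t * ∑ i, if σ i then -a i else a i) * Real.exp (-(N * t ^ 2)) := by
    rw [Finset.card_filter, Nat.cast_sum]
    refine Finset.sum_le_sum fun σ _ => ?_
    split_ifs with h
    · rw [← Real.exp_add, Nat.cast_one]
      refine Real.one_le_exp ?_
      have := mul_le_mul_of_nonneg_left h ht
      nlinarith
    · rw [Nat.cast_zero]; positivity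
  refine hle.trans ?_
  rw [← Finset.sum_mul, hsum]
  refine (mul_le_mul_of_nonneg_right hcosh (Real.exp_nonneg _)).trans_eq ?_
  rw [mul_assoc, ← Real.exp_add]
  congr 2; ring

/-- Exchanges the two components of the pairs selected by `σ`. -/
def swapPairs {N : ℕ} {Z : Type*} (σ : Fin N → Bool) (w : Fin N → Z × Z) : Fin N → Z × Z :=
  fun i => if σ i then (w i).swap else w i

/-- Total loss on the second components minus total loss on the first components. -/
def lossGap {X : Type*} {N : ℕ} (h : X → Bool) (w : Fin N → (X × Bool) × (X × Bool)) : ℝ :=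
  ∑ i, (zeroOneLoss h (w i).2 - zeroOneLoss h (w i).1)

theorem zeroOneLoss_mem_Icc {X : Type*} (h : X → Bool) (z : X × Bool) :
    zeroOneLoss h z ∈ Icc (0 : ℝ) 1 := by
  unfold zeroOneLoss
  split_ifs <;> simp

theorem lossGap_swapPairs {X : Type*} {N : ℕ} (h : X → Bool) (σ : Fin N → Bool)
    (w : Fin N → (X × Bool) × (X × Bool)) :
    lossGap h (swapPairs σ w) = ∑ i, if σ i then
      -(zeroOneLoss h (w i).2 - zeroOneLoss h (w i).1)
      else zeroOneLoss h (w i).2 - zeroOneLoss h (w i).1 := by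
  refine Finset.sum_congr rfl fun i _ => ?_
  unfold swapPairs
  split_ifs <;> simp

open scoped Classical in
/-- For a fixed double sample, few exchanges produce a classifier with a large loss gap: there are
polynomially many traces on the sample, and exponentially few exchanges for each. -/
theorem card_swapPairs_le {Θ X : Type*} {f : Θ → X → Bool} {d : ℕ} (hd : vcDim f ≤ d) {N : ℕ}
    {t : ℝ} (ht : 0 ≤ t) (w : Fin N → (X × Bool) × (X × Bool)) :
    ((Finset.univ.filter fun σ : Fin N → Bool =>
      ∃ θ, N * t ≤ lossGap (f θ) (swapPairs σ w)).card : ℝ)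
      ≤ (2 * N + 1) ^ d * Real.exp (-(N * t ^ 2 / 2)) * 2 ^ N := by
  let z : Fin N × Bool → X := fun q => if q.2 then (w q.1).2.1 else (w q.1).1.1
  have hex : ∀ τ : traces f z, ∃ θ, ∀ i, i ∈ τ.1 ↔ f θ (z i) = true :=
    fun τ => (Finset.mem_filter.1 τ.2).2
  choose θ₀ hθ₀ using hex
  have hsub : (Finset.univ.filter fun σ : Fin N → Bool =>
      ∃ θ, N * t ≤ lossGap (f θ) (swapPairs σ w)) ⊆
      (traces f z).attach.biUnion fun τ => Finset.univ.filter fun σ : Fin N → Bool =>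
        N * t ≤ lossGap (f (θ₀ τ)) (swapPairs σ w) := by
    intro σ hσ
    obtain ⟨θ, hθ⟩ := (Finset.mem_filter.1 hσ).2
    let τ : traces f z := ⟨Finset.univ.filter fun q => f θ (z q) = true,
      Finset.mem_filter.2 ⟨Finset.mem_univ _, θ, by simp⟩⟩
    have hτ : ∀ q, f (θ₀ τ) (z q) = f θ (z q) := fun q => by
      rw [Bool.eq_iff_iff, ← hθ₀ τ q]
      simp [τ]
    refine Finset.mem_biUnion.2 ⟨τ, Finset.mem_attach _ _, Finset.mem_filter.2
      ⟨Finset.mem_univ _, ?_⟩⟩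
    convert hθ using 1
    rw [lossGap_swapPairs, lossGap_swapPairs]
    have h1 : ∀ i, f (θ₀ τ) (w i).1.1 = f θ (w i).1.1 := fun i => by simpa [z] using hτ (i, false)
    have h2 : ∀ i, f (θ₀ τ) (w i).2.1 = f θ (w i).2.1 := fun i => by simpa [z] using hτ (i, true)
    simp only [zeroOneLoss, h1, h2]
  have hcard : ((traces f z).card : ℝ) ≤ (2 * N + 1) ^ d := by
    have h := card_traces_le f z hd
    rw [Fintype.card_prod, Fintype.card_fin, Fintype.card_bool, mul_comm N 2] at h
    exact_mod_cast h
  have hone : ∀ τ ∈ (traces f z).attach, ((Finset.univ.filter fun σ : Fin N → Bool =>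
      N * t ≤ lossGap (f (θ₀ τ)) (swapPairs σ w)).card : ℝ)
      ≤ 2 ^ N * Real.exp (-(N * t ^ 2 / 2)) := by
    intro τ _
    simp_rw [lossGap_swapPairs]
    refine card_signs_le _ (fun i => ?_) ht
    have h1 := zeroOneLoss_mem_Icc (f (θ₀ τ)) (w i).1
    have h2 := zeroOneLoss_mem_Icc (f (θ₀ τ)) (w i).2
    rw [abs_le]
    constructor <;> linarith [h1.1, h1.2, h2.1, h2.2]
  have hle : ((Finset.univ.filter fun σ : Fin N → Bool =>
      ∃ θ, N * t ≤ lossGap (f θ) (swapPairs σ w)).card : ℝ) ≤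
      ∑ τ ∈ (traces f z).attach, ((Finset.univ.filter fun σ : Fin N → Bool =>
        N * t ≤ lossGap (f (θ₀ τ)) (swapPairs σ w)).card : ℝ) := by
    exact_mod_cast (Finset.card_le_card hsub).trans Finset.card_biUnion_le
  refine (hle.trans (Finset.sum_le_card_nsmul _ _ _ hone)).trans ?_
  rw [Finset.card_attach, nsmul_eq_mul, mul_comm (2 ^ N : ℝ), ← mul_assoc]
  gcongr

/-! ### Ghost sample -/

theorem measurable_zeroOneLoss_uncurry {Θ X : Type*} [MeasurableSpace X] [MeasurableSpace Θ]
    {f : Θ → X → Bool} (hf : Measurable (fun q : Θ × X => f q.1 q.2)) :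
    Measurable (fun q : Θ × (X × Bool) => zeroOneLoss (f q.1) q.2) := by
  unfold zeroOneLoss
  refine Measurable.ite (measurableSet_eq_fun ?_ ?_) measurable_const measurable_const
  · exact hf.comp (measurable_fst.prodMk (measurable_fst.comp measurable_snd))
  · exact measurable_snd.comp measurable_snd

/-- Hoeffding's inequality for the lower tail of an i.i.d. sum with values in `[0, 1]`. -/
theorem measureReal_le_sum_integral_sub_le {Z : Type*} [MeasurableSpace Z] (μ : Measure Z)
    [IsProbabilityMeasure μ] {l : Z → ℝ} (hl : Measurable l) (hl01 : ∀ z, l z ∈ Icc (0 : ℝ) 1)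
    {N : ℕ} (hN : 0 < N) {δ : ℝ} (hδ : 0 ≤ δ) :
    (Measure.pi fun _ : Fin N => μ).real {S | N * δ ≤ ∑ i, (∫ z, l z ∂μ - l (S i))}
      ≤ Real.exp (-(2 * N * δ ^ 2)) := by
  set m := ∫ z, l z ∂μ with hm
  have hind : ProbabilityTheory.iIndepFun (fun (i : Fin N) (S : Fin N → Z) => m - l (S i))
      (Measure.pi fun _ : Fin N => μ) :=
    ProbabilityTheory.iIndepFun_pi (X := fun _ z => m - l z)
      fun i => (measurable_const.sub hl).aemeasurable
  have hsub : ∀ i ∈ (Finset.univ : Finset (Fin N)), ProbabilityTheory.HasSubgaussianMGF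
      (fun S : Fin N → Z => m - l (S i)) ((‖(0 : ℝ) - (-1)‖₊ / 2) ^ 2)
      (Measure.pi fun _ : Fin N => μ) := by
    intro i _
    have hmi : Measurable fun S : Fin N → Z => - l (S i) := (hl.comp (measurable_pi_apply i)).neg
    have h := ProbabilityTheory.hasSubgaussianMGF_of_mem_Icc
      (μ := Measure.pi fun _ : Fin N => μ) (a := -1) (b := 0) hmi.aemeasurable
      (Eventually.of_forall fun S => ⟨by linarith [(hl01 (S i)).2], by linarith [(hl01 (S i)).1]⟩)
    have hmean : ∫ S : Fin N → Z, - l (S i) ∂(Measure.pi fun _ : Fin N => μ) = -m := by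
      rw [integral_neg, hm]
      congr 1
      have hev := measurePreserving_eval (fun _ : Fin N => μ) i
      conv_rhs => rw [← hev.map_eq]
      rw [integral_map hev.measurable.aemeasurable hl.aestronglyMeasurable]
    rw [hmean] at h
    refine h.congr (Eventually.of_forall fun S => ?_)
    ring
  have h := ProbabilityTheory.HasSubgaussianMGF.measure_sum_ge_le_of_iIndepFun hind hsub
    (ε := N * δ) (by positivity)
  refine h.trans_eq ?_
  have hN' : (N : ℝ) ≠ 0 := by positivity
  congr 1
  simp
  field_simp

theorem measurePreserving_swapPairs {Z : Type*} [MeasurableSpace Z] (μ : Measure Z)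
    [IsProbabilityMeasure μ] {N : ℕ} (σ : Fin N → Bool) :
    MeasurePreserving (swapPairs σ) (Measure.pi fun _ : Fin N => μ.prod μ)
      (Measure.pi fun _ : Fin N => μ.prod μ) := by
  refine measurePreserving_pi (fun _ : Fin N => μ.prod μ) (fun _ : Fin N => μ.prod μ)
    (f := fun i q => if σ i then q.swap else q) fun i => ?_
  cases σ i
  · exact MeasurePreserving.id _
  · exact Measure.measurePreserving_swap

open scoped Classical in
/-- An event that holds for at most a fraction `c` of the exchanges of any double sample has
probability at most `c`, as the law of the double sample is invariant under exchanges. -/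
theorem measure_le_of_card_swapPairs_le {Z : Type*} [MeasurableSpace Z] (μ : Measure Z)
    [IsProbabilityMeasure μ] {N : ℕ} {T : Set (Fin N → Z × Z)} (hT : MeasurableSet T) {c : ℝ}
    (hc : ∀ w, ((Finset.univ.filter fun σ : Fin N → Bool => swapPairs σ w ∈ T).card : ℝ)
      ≤ c * 2 ^ N) :
    (Measure.pi fun _ : Fin N => μ.prod μ) T ≤ ENNReal.ofReal c := by
  set Q := Measure.pi fun _ : Fin N => μ.prod μ with hQ
  have hpre : ∀ σ : Fin N → Bool, MeasurableSet (swapPairs σ ⁻¹' T) := fun σ =>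
    (measurePreserving_swapPairs μ σ).measurable hT
  have h1 : (2 ^ N : ENNReal) * Q T
      = ∫⁻ w, ∑ σ : Fin N → Bool, (swapPairs σ ⁻¹' T).indicator 1 w ∂Q := by
    rw [lintegral_finsetSum _ fun σ _ => measurable_one.indicator (hpre σ)]
    have h : ∀ σ ∈ (Finset.univ : Finset (Fin N → Bool)),
        ∫⁻ w, (swapPairs σ ⁻¹' T).indicator 1 w ∂Q = Q T := fun σ _ => by
      rw [lintegral_indicator_one (hpre σ),
        (measurePreserving_swapPairs μ σ).measure_preimage hT.nullMeasurableSet]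
    rw [Finset.sum_congr rfl h]
    simp
  have h2 : ∀ w, ∑ σ : Fin N → Bool, (swapPairs σ ⁻¹' T).indicator (1 : (Fin N → Z × Z) → ENNReal) w
      ≤ ENNReal.ofReal (c * 2 ^ N) := by
    intro w
    have : ∑ σ : Fin N → Bool, (swapPairs σ ⁻¹' T).indicator (1 : (Fin N → Z × Z) → ENNReal) w
        = ((Finset.univ.filter fun σ : Fin N → Bool => swapPairs σ w ∈ T).card : ENNReal) := by
      rw [Finset.card_filter, Nat.cast_sum]
      refine Finset.sum_congr rfl fun σ _ => ?_
      simp [Set.indicator_apply]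
    rw [this, ← ENNReal.ofReal_natCast]
    exact ENNReal.ofReal_le_ofReal (hc w)
  have h3 : (2 ^ N : ENNReal) * Q T ≤ 2 ^ N * ENNReal.ofReal c := by
    rw [h1]
    refine (lintegral_mono h2).trans_eq ?_
    rw [lintegral_const, measure_univ, mul_one, mul_comm, ENNReal.ofReal_mul (by positivity),
      ENNReal.ofReal_pow zero_le_two, ENNReal.ofReal_ofNat]
  exact (ENNReal.mul_le_mul_iff_right (by positivity) (by finiteness)).1 h3

/-- The probability that two independent samples have a large loss gap for some classifier. Random
exchanges need a measurable event; measurable projection provides one, up to a null set. -/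
theorem measure_exists_le_lossGap_le {X Θ : Type*} [MeasurableSpace X] [MeasurableSpace Θ]
    [StandardBorelSpace Θ] {f : Θ → X → Bool} (hf : Measurable (fun q : Θ × X => f q.1 q.2))
    {d : ℕ} (hd : vcDim f ≤ d) (μ : Measure (X × Bool)) [IsProbabilityMeasure μ] {N : ℕ}
    {t : ℝ} (ht : 0 ≤ t) :
    (Measure.pi fun _ : Fin N => μ.prod μ) {w | ∃ θ, N * t ≤ lossGap (f θ) w}
      ≤ ENNReal.ofReal ((2 * N + 1) ^ d * Real.exp (-(N * t ^ 2 / 2))) := by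
  classical
  have hC : MeasurableSet {q : Θ × (Fin N → (X × Bool) × (X × Bool)) |
      N * t ≤ lossGap (f q.1) q.2} := by
    refine measurableSet_le measurable_const (Finset.measurable_fun_sum _ fun i _ => ?_)
    have hi : Measurable fun q : Θ × (Fin N → (X × Bool) × (X × Bool)) => q.2 i :=
      (measurable_pi_apply i).comp measurable_snd
    exact ((measurable_zeroOneLoss_uncurry hf).comp (measurable_fst.prodMk hi.snd)).sub
      ((measurable_zeroOneLoss_uncurry hf).comp (measurable_fst.prodMk hi.fst))
  obtain ⟨T, hTsub, hT, hTae⟩ := (nullMeasurableSet_exists_prod_mem hC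
    (Measure.pi fun _ : Fin N => μ.prod μ)).exists_measurable_subset_ae_eq
  have hmeas := measure_congr hTae
  refine (hmeas.symm.le.trans (measure_le_of_card_swapPairs_le μ hT fun w => ?_) :)
  refine le_trans ?_ (card_swapPairs_le hd ht w)
  exact_mod_cast Finset.card_le_card fun σ hσ => Finset.mem_filter.2
    ⟨Finset.mem_univ _, hTsub (Finset.mem_filter.1 hσ).2⟩

/-- Symmetrization: if the section of `G` over each point of `B` has probability at least one half,
then the outer measure of `B` is at most twice that of `G`. No measurability is needed. -/
theorem measure_le_two_mul_prod {Ω Ω' : Type*} [MeasurableSpace Ω] [MeasurableSpace Ω']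
    (P : Measure Ω) (P' : Measure Ω') [SFinite P'] {B : Set Ω} {G : Set (Ω × Ω')}
    (h : ∀ x ∈ B, 2⁻¹ ≤ P' (Prod.mk x ⁻¹' G)) : P B ≤ 2 * (P.prod P') G := by
  set T := toMeasurable (P.prod P') G with hTdef
  have hT : MeasurableSet T := measurableSet_toMeasurable _ _
  have hB : B ⊆ {x | 2⁻¹ ≤ P' (Prod.mk x ⁻¹' T)} := fun x hx =>
    (h x hx).trans (measure_mono (preimage_mono (subset_toMeasurable _ _)))
  have hM := mul_meas_ge_le_lintegral (μ := P) (measurable_measure_prodMk_left (ν := P') hT) 2⁻¹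
  rw [← Measure.prod_apply hT, hTdef, measure_toMeasurable] at hM
  calc P B ≤ P {x | 2⁻¹ ≤ P' (Prod.mk x ⁻¹' T)} := measure_mono hB
    _ = 2 * (2⁻¹ * P {x | 2⁻¹ ≤ P' (Prod.mk x ⁻¹' T)}) := by
      rw [← mul_assoc, ENNReal.mul_inv_cancel (by simp) (by simp), one_mul]
    _ ≤ 2 * (P.prod P') G := by gcongr

/-- One-sided uniform deviation inequality with a free deviation `ε`, for sample sizes large enough
that a ghost sample deviates by `ε / 4` with probability at most one half. -/
theorem measure_exists_deviation_le {X Θ : Type*} [MeasurableSpace X] [MeasurableSpace Θ]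
    [StandardBorelSpace Θ] {f : Θ → X → Bool} (hf : Measurable (fun q : Θ × X => f q.1 q.2))
    {d : ℕ} (hd : vcDim f ≤ d) (μ : Measure (X × Bool)) [IsProbabilityMeasure μ] {N : ℕ}
    (hN : 0 < N) {ε : ℝ} (hε : 0 ≤ ε) (hlarge : Real.log 2 ≤ N * ε ^ 2 / 8) :
    (Measure.pi fun _ : Fin N => μ) {S | ∃ θ, empiricalLoss (f θ) S + ε < expectedLoss (f θ) μ}
      ≤ ENNReal.ofReal (2 * ((2 * N + 1) ^ d * Real.exp (-(N * (3 / 4 * ε) ^ 2 / 2)))) := by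
  set P := Measure.pi fun _ : Fin N => μ with hP
  have hN' : (0 : ℝ) < N := by exact_mod_cast hN
  let e := MeasurableEquiv.arrowProdEquivProdArrow (X × Bool) (X × Bool) (Fin N)
  let W : Set (Fin N → (X × Bool) × (X × Bool)) :=
    {w | ∃ θ, N * (3 / 4 * ε) ≤ lossGap (f θ) w}
  have hWe : (P.prod P) (e.symm ⁻¹' W) = (Measure.pi fun _ : Fin N => μ.prod μ) W :=
    ((measurePreserving_arrowProdEquivProdArrow (X × Bool) (X × Bool) (Fin N)
      (fun _ => μ) (fun _ => μ)).symm).measure_preimage_equiv W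
  rw [ENNReal.ofReal_mul zero_le_two, ENNReal.ofReal_ofNat]
  refine (measure_le_two_mul_prod P P (G := e.symm ⁻¹' W) ?_).trans ?_
  · rintro S ⟨θ, hθ⟩
    have hlm : Measurable (zeroOneLoss (f θ)) :=
      (measurable_zeroOneLoss_uncurry hf).comp (measurable_const.prodMk measurable_id)
    set m := ∫ z, zeroOneLoss (f θ) z ∂μ with hm
    set A : Set (Fin N → X × Bool) :=
      {S' | N * (ε / 4) ≤ ∑ i, (m - zeroOneLoss (f θ) (S' i))} with hA
    have hAm : MeasurableSet A := measurableSet_le measurable_const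
      (Finset.measurable_fun_sum _ fun i _ =>
        measurable_const.sub (hlm.comp (measurable_pi_apply i)))
    have hAle : P.real A ≤ 2⁻¹ := by
      refine (measureReal_le_sum_integral_sub_le μ hlm (fun z => zeroOneLoss_mem_Icc _ z) hN
        (by positivity : 0 ≤ ε / 4)).trans ?_
      rw [← Real.exp_log (show (0 : ℝ) < 2⁻¹ by norm_num), Real.exp_le_exp, Real.log_inv]
      linarith [show 2 * (N : ℝ) * (ε / 4) ^ 2 = N * ε ^ 2 / 8 by ring]
    have hAc : (2⁻¹ : ENNReal) ≤ P Aᶜ := by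
      have h1 : (2⁻¹ : ℝ) ≤ P.real Aᶜ := by
        rw [probReal_compl_eq_one_sub hAm]; linarith
      have h2 := ENNReal.ofReal_le_ofReal h1
      rwa [ofReal_measureReal, ENNReal.ofReal_inv_of_pos zero_lt_two, ENNReal.ofReal_ofNat] at h2
    refine hAc.trans (measure_mono fun S' hS' => ?_)
    change ∃ θ, N * (3 / 4 * ε) ≤ lossGap (f θ) (e.symm (S, S'))
    refine ⟨θ, ?_⟩
    have hgap : lossGap (f θ) (e.symm (S, S'))
        = ∑ i, zeroOneLoss (f θ) (S' i) - ∑ i, zeroOneLoss (f θ) (S i) := by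
      rw [← Finset.sum_sub_distrib]; rfl
    have h1 : ∑ i, (m - zeroOneLoss (f θ) (S' i)) < N * (ε / 4) := not_le.1 hS'
    rw [Finset.sum_sub_distrib, Finset.sum_const, Finset.card_univ, Fintype.card_fin,
      nsmul_eq_mul] at h1
    have h2 : (∑ i, zeroOneLoss (f θ) (S i)) / N + ε < m := hθ
    have h3 : ∑ i, zeroOneLoss (f θ) (S i) < N * (m - ε) := by
      rw [← div_lt_iff₀' hN']; linarith
    rw [hgap]
    linarith
  · rw [hWe]
    gcongr
    exact measure_exists_le_lossGap_le hf hd μ (by positivity)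

/-- One-sided uniform deviation inequality (Vapnik-Chervonenkis) at confidence `1 - p`. -/
theorem measure_exists_deviation_le_confidence {X Θ : Type*} [MeasurableSpace X]
    [MeasurableSpace Θ] [StandardBorelSpace Θ] {f : Θ → X → Bool}
    (hf : Measurable (fun q : Θ × X => f q.1 q.2)) {d : ℕ} (hd : vcDim f ≤ d)
    (μ : Measure (X × Bool)) [IsProbabilityMeasure μ] {N : ℕ} (hN : 0 < N) {p : ℝ}
    (hp : p ∈ Ioo (0 : ℝ) 1) :
    (Measure.pi fun _ : Fin N => μ) {S | ∃ θ, empiricalLoss (f θ) S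
        + 2 * Real.sqrt ((2 * d * Real.log (2 * N) + Real.log (4 / p)) / N)
        < expectedLoss (f θ) μ} ≤ ENNReal.ofReal p := by
  set a := 2 * d * Real.log (2 * N) + Real.log (4 / p) with ha
  have hN1 : (1 : ℝ) ≤ N := by exact_mod_cast hN
  have hp0 : 0 < p := hp.1
  have hlogN : 0 ≤ Real.log (2 * N) := Real.log_nonneg (by linarith)
  have hlog4 : 2 * Real.log 2 ≤ Real.log (4 / p) := by
    rw [show 2 * Real.log 2 = Real.log 4 by
      rw [show (4 : ℝ) = 2 ^ 2 by norm_num, Real.log_pow]; norm_num]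
    refine Real.log_le_log (by norm_num) ?_
    rw [le_div_iff₀ hp0]; linarith [hp.2]
  have ha2 : 2 * Real.log 2 ≤ a := by
    have : 0 ≤ 2 * d * Real.log (2 * N) := by positivity
    linarith
  have ha0 : 0 ≤ a := le_trans (by positivity) ha2
  have hsq : N * (2 * Real.sqrt (a / N)) ^ 2 = 4 * a := by
    rw [mul_pow, Real.sq_sqrt (by positivity)]
    field_simp
    ring
  refine (measure_exists_deviation_le hf hd μ hN (by positivity) ?_).trans
    (ENNReal.ofReal_le_ofReal ?_)
  · rw [hsq]; linarith
  -- the exponent is `9 / 8 * a ≥ a`, and `2 * N + 1 ≤ (2 * N) ^ 2` absorbs the growth function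
  have hexp : Real.exp (-(N * (3 / 4 * (2 * Real.sqrt (a / N))) ^ 2 / 2)) ≤ Real.exp (-a) := by
    rw [Real.exp_le_exp]
    have : N * (3 / 4 * (2 * Real.sqrt (a / N))) ^ 2 / 2 = 9 / 32 * (4 * a) := by
      rw [← hsq]; ring
    rw [this]; linarith
  have hexpa : Real.exp a = (2 * N) ^ (2 * d) * (4 / p) := by
    rw [ha, Real.exp_add, Real.exp_log (by positivity)]
    congr 1
    rw [show (2 * d * Real.log (2 * N) : ℝ) = (2 * d : ℕ) * Real.log (2 * N) by push_cast; ring,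
      Real.exp_nat_mul, Real.exp_log (by positivity)]
  have hgrow : (2 * N + 1 : ℝ) ^ d ≤ (2 * N) ^ (2 * d) := by
    rw [pow_mul]
    gcongr
    nlinarith
  calc 2 * ((2 * N + 1) ^ d * Real.exp (-(N * (3 / 4 * (2 * Real.sqrt (a / N))) ^ 2 / 2)))
      ≤ 2 * ((2 * N) ^ (2 * d) * Real.exp (-a)) := by gcongr
    _ = p / 2 := by
      rw [Real.exp_neg, hexpa]
      have : ((2 * N : ℝ)) ^ (2 * d) ≠ 0 := by positivity
      field_simp
      norm_num
    _ ≤ p := by linarith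

/-! ### Domain adaptation -/

theorem isProbabilityMeasure_mixture {Z : Type*} [MeasurableSpace Z] {R : ℕ} {α : Fin R → ℝ}
    (hα : ∀ r, 0 ≤ α r) (hα1 : ∑ r, α r = 1) (D : Fin R → Measure Z)
    [∀ r, IsProbabilityMeasure (D r)] : IsProbabilityMeasure (mixture α D) := by
  constructor
  simp only [mixture, Measure.finsetSum_apply, Measure.smul_apply, measure_univ, smul_eq_mul,
    mul_one]
  rw [← ENNReal.ofReal_sum_of_nonneg fun r _ => hα r, hα1, ENNReal.ofReal_one]

theorem mixture_real_apply {Z : Type*} [MeasurableSpace Z] {R : ℕ} {α : Fin R → ℝ}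
    (hα : ∀ r, 0 ≤ α r) (D : Fin R → Measure Z) [∀ r, IsProbabilityMeasure (D r)] (A : Set Z) :
    (mixture α D).real A = ∑ r, α r * (D r).real A := by
  simp only [mixture, Measure.real, Measure.finsetSum_apply, Measure.smul_apply, smul_eq_mul]
  rw [ENNReal.toReal_sum fun r _ => by finiteness]
  exact Finset.sum_congr rfl fun r _ => by rw [ENNReal.toReal_mul, ENNReal.toReal_ofReal (hα r)]

theorem expectedLoss_eq_measureReal {X : Type*} [MeasurableSpace X] {h : X → Bool}
    (hh : Measurable h) (D : Measure (X × Bool)) :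
    expectedLoss h D = D.real {z | h z.1 ≠ z.2} := by
  have hs : MeasurableSet {z : X × Bool | h z.1 ≠ z.2} :=
    (measurableSet_eq_fun (hh.comp measurable_fst) measurable_snd).compl
  rw [expectedLoss, ← integral_indicator_one hs]
  congr 1
  ext z
  by_cases hz : h z.1 = z.2 <;> simp [zeroOneLoss, hz]

theorem fst_real_disagree {X : Type*} [MeasurableSpace X] {h h' : X → Bool} (hh : Measurable h)
    (hh' : Measurable h') (D : Measure (X × Bool)) :
    D.fst.real {x | h x ≠ h' x} = D.real {z | h z.1 ≠ h' z.1} := by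
  have hs : MeasurableSet {x | h x ≠ h' x} := (measurableSet_eq_fun hh hh').compl
  rw [Measure.real, Measure.fst_apply hs]
  rfl

/-- Two classifiers disagree at most as often as one of them errs. -/
theorem fst_real_disagree_le {X : Type*} [MeasurableSpace X] {h h' : X → Bool}
    (hh : Measurable h) (hh' : Measurable h') (D : Measure (X × Bool)) [IsFiniteMeasure D] :
    D.fst.real {x | h x ≠ h' x} ≤ expectedLoss h D + expectedLoss h' D := by
  rw [fst_real_disagree hh hh', expectedLoss_eq_measureReal hh, expectedLoss_eq_measureReal hh']
  refine (measureReal_mono fun z hz => ?_).trans (measureReal_union_le _ _)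
  by_contra hcon
  simp only [mem_union, mem_ofPred_eq, not_or, not_not] at hcon
  exact hz (hcon.1.trans hcon.2.symm)

theorem expectedLoss_le_add_disagree {X : Type*} [MeasurableSpace X] {h h' : X → Bool}
    (hh : Measurable h) (hh' : Measurable h') (D : Measure (X × Bool)) [IsFiniteMeasure D] :
    expectedLoss h D ≤ expectedLoss h' D + D.fst.real {x | h x ≠ h' x} := by
  rw [fst_real_disagree hh hh', expectedLoss_eq_measureReal hh, expectedLoss_eq_measureReal hh']
  refine (measureReal_mono fun z hz => ?_).trans (measureReal_union_le _ _)
  by_contra hcon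
  simp only [mem_union, mem_ofPred_eq, not_or, not_not] at hcon
  exact hz (hcon.2.trans hcon.1)

theorem abs_sub_le_half_hDeltaHDiv {Θ X : Type*} [MeasurableSpace X] (f : Θ → X → Bool)
    (P Q : Measure X) [IsProbabilityMeasure P] [IsProbabilityMeasure Q] (θ θ' : Θ) :
    |P.real {x | f θ x ≠ f θ' x} - Q.real {x | f θ x ≠ f θ' x}| ≤ 1 / 2 * hDeltaHDiv f P Q := by
  have hbdd : BddAbove (range fun τ : Θ × Θ =>
      |P.real {x | f τ.1 x ≠ f τ.2 x} - Q.real {x | f τ.1 x ≠ f τ.2 x}|) := by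
    refine ⟨1, ?_⟩
    rintro _ ⟨τ, rfl⟩
    exact abs_sub_le_of_nonneg_of_le measureReal_nonneg measureReal_le_one
      measureReal_nonneg measureReal_le_one
  have h := le_ciSup hbdd (θ, θ')
  rw [hDeltaHDiv]
  linarith

/-- Disagreement probabilities under the target exceed those under a mixture of sources by at most
half the averaged divergence. -/
theorem fst_real_disagree_le_mixture {Θ X : Type*} [MeasurableSpace X] {f : Θ → X → Bool}
    (hf : ∀ θ, Measurable (f θ)) {R : ℕ} {α : Fin R → ℝ} (hα : ∀ r, 0 ≤ α r)
    (hα1 : ∑ r, α r = 1) (Dq : Fin R → Measure (X × Bool)) [∀ r, IsProbabilityMeasure (Dq r)]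
    (Dp : Measure (X × Bool)) [IsProbabilityMeasure Dp] (θ θ' : Θ) :
    Dp.fst.real {x | f θ x ≠ f θ' x} ≤ (mixture α Dq).fst.real {x | f θ x ≠ f θ' x}
      + 1 / 2 * ∑ r, α r * hDeltaHDiv f (Dq r).fst Dp.fst := by
  rw [fst_real_disagree (hf θ) (hf θ') (mixture α Dq), mixture_real_apply hα, Finset.mul_sum,
    ← Finset.sum_add_distrib]
  calc Dp.fst.real {x | f θ x ≠ f θ' x}
      = ∑ r, α r * Dp.fst.real {x | f θ x ≠ f θ' x} := by rw [← Finset.sum_mul, hα1, one_mul]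
    _ ≤ _ := Finset.sum_le_sum fun r _ => by
      have h := abs_sub_le_half_hDeltaHDiv f (Dq r).fst Dp.fst θ θ'
      rw [fst_real_disagree (hf θ) (hf θ') (Dq r)] at h
      have h' := mul_le_mul_of_nonneg_left (abs_le.1 h).1 (hα r)
      linarith

/-- Domain adaptation bound through a comparison classifier `f θ'`. -/
theorem expectedLoss_le_comparison {Θ X : Type*} [MeasurableSpace X] {f : Θ → X → Bool}
    (hf : ∀ θ, Measurable (f θ)) {R : ℕ} {α : Fin R → ℝ} (hα : ∀ r, 0 ≤ α r)
    (hα1 : ∑ r, α r = 1) (Dq : Fin R → Measure (X × Bool)) [∀ r, IsProbabilityMeasure (Dq r)]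
    (Dp : Measure (X × Bool)) [IsProbabilityMeasure Dp] (θ θ' : Θ) :
    expectedLoss (f θ) Dp ≤ expectedLoss (f θ) (mixture α Dq)
      + 1 / 2 * ∑ r, α r * hDeltaHDiv f (Dq r).fst Dp.fst
      + (expectedLoss (f θ') (mixture α Dq) + expectedLoss (f θ') Dp) := by
  have := isProbabilityMeasure_mixture hα hα1 Dq
  have h1 := expectedLoss_le_add_disagree (hf θ) (hf θ') Dp
  have h2 := fst_real_disagree_le_mixture hf hα hα1 Dq Dp θ θ'
  have h3 := fst_real_disagree_le (hf θ) (hf θ') (mixture α Dq)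
  linarith

end DomainAdaptation

end

theorem theorem1 {X Θ : Type*} [MeasurableSpace X] [MeasurableSpace Θ] [StandardBorelSpace Θ]
    (f : Θ → X → Bool) (hf : Measurable (fun q : Θ × X => f q.1 q.2))
    (d : ℕ) (hd : DomainAdaptation.vcDim f = (d : ℕ∞))
    {R : ℕ} (α : Fin R → ℝ) (hα : ∀ r, α r ∈ Set.Icc (0 : ℝ) 1) (hα1 : ∑ r, α r = 1)
    (Dq : Fin R → MeasureTheory.Measure (X × Bool))
    [∀ r, MeasureTheory.IsProbabilityMeasure (Dq r)]
    (Dp : MeasureTheory.Measure (X × Bool)) [MeasureTheory.IsProbabilityMeasure Dp]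
    (N : ℕ) (hN : 0 < N) (p : ℝ) (hp : p ∈ Set.Ioo (0 : ℝ) 1) :
    ∃ E : Set (Fin N → X × Bool), MeasurableSet E ∧
      ENNReal.ofReal (1 - p) ≤
        MeasureTheory.Measure.pi (fun _ : Fin N => DomainAdaptation.mixture α Dq) E ∧
      ∀ S ∈ E, ∀ θ : Θ,
        DomainAdaptation.expectedLoss (f θ) Dp ≤
          DomainAdaptation.errorBound f d p α Dq Dp S θ
            (DomainAdaptation.jointLossEmp f S Dp) ∧
        DomainAdaptation.expectedLoss (f θ) Dp ≤
          DomainAdaptation.errorBound f d p α Dq Dp S θ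
            (DomainAdaptation.jointLoss f (DomainAdaptation.mixture α Dq) Dp) := by
  have hα0 : ∀ r, 0 ≤ α r := fun r => (hα r).1
  have hprob := DomainAdaptation.isProbabilityMeasure_mixture hα0 hα1 Dq
  have hfθ : ∀ θ, Measurable (f θ) := fun θ => hf.comp measurable_prodMk_left
  set μ := DomainAdaptation.mixture α Dq with hμ
  set P := MeasureTheory.Measure.pi fun _ : Fin N => μ with hP
  set s := Real.sqrt ((2 * d * Real.log (2 * N) + Real.log (4 / p)) / N) with hs
  have hs0 : 0 ≤ s := Real.sqrt_nonneg _
  set B : Set (Fin N → X × Bool) := {S | ∃ θ, DomainAdaptation.empiricalLoss (f θ) S + 2 * s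
    < DomainAdaptation.expectedLoss (f θ) μ} with hB
  have hPB : P B ≤ ENNReal.ofReal p :=
    DomainAdaptation.measure_exists_deviation_le_confidence hf hd.le μ hN hp
  refine ⟨(MeasureTheory.toMeasurable P B)ᶜ,
    (MeasureTheory.measurableSet_toMeasurable P B).compl, ?_, fun S hS θ => ?_⟩
  · rw [MeasureTheory.prob_compl_eq_one_sub (MeasureTheory.measurableSet_toMeasurable P B),
      MeasureTheory.measure_toMeasurable, ENNReal.ofReal_sub _ hp.1.le, ENNReal.ofReal_one]
    exact tsub_le_tsub_left hPB 1
  have hdev : ∀ θ, DomainAdaptation.expectedLoss (f θ) μ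
      ≤ DomainAdaptation.empiricalLoss (f θ) S + 2 * s := fun θ' => by
    by_contra! hcon
    exact hS (MeasureTheory.subset_toMeasurable P B ⟨θ', hcon⟩)
  have hcmp := DomainAdaptation.expectedLoss_le_comparison hfθ hα0 hα1 Dq Dp θ
  simp only [← hμ] at hcmp
  have : Nonempty Θ := ⟨θ⟩
  have hinf : ∀ ξ : Θ → ℝ, (∀ θ', DomainAdaptation.expectedLoss (f θ) Dp
      ≤ DomainAdaptation.errorBound f d p α Dq Dp S θ (ξ θ')) →
      DomainAdaptation.expectedLoss (f θ) Dp
        ≤ DomainAdaptation.errorBound f d p α Dq Dp S θ (⨅ θ', ξ θ') := fun ξ hξ => by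
    simp only [DomainAdaptation.errorBound, ← sub_le_iff_le_add'] at hξ ⊢
    exact le_ciInf hξ
  constructor
  -- the empirical joint loss costs a second deviation, for the comparison classifier
  · refine hinf _ fun θ' => ?_
    rw [DomainAdaptation.errorBound, ← hs]
    linarith [hcmp θ', hdev θ, hdev θ']
  · refine hinf _ fun θ' => ?_
    rw [DomainAdaptation.errorBound, ← hs]
    linarith [hcmp θ', hdev θ]
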